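/- All $C^*$-algebras and Hilbert spaces are complex; inner products are linear in the variables indicated, and closures of products or of sets of inner products are closed linear spans. **Definitions.** A $C$-$D$-equivalence bimodule $Y$ is a complex Banach space with a left $C$-action, a right $D$-action, a full left $C$-valued inner product ${}_C\langle\cdot,\cdot\rangle$ (linear in the first variable) and a full right $D$-valued inner product $\langle\cdot,\cdot\rangle_D$ (linear in the second variable), which make it a left Hilbert $C$-module and a right Hilbert $D$-module with the given norm, on which each algebra acts by adjointable operators for the other inner product, and such that ${}_C\langle x,y\rangle\cdot z=x\cdot\langle y,z\rangle_D$ for all $x,y,z\in Y$. Let $A\subset C$ and $B\subset D$ be inclusions of $C^*$-algebras. They are strongly Morita equivalent with respect to a $C$-$D$-equivalence bimodule $Y$ and a closed subspace $X\subset Y$ if $A\cdot X\subset X$, $X\cdot B\subset X$, ${}_C\langle X,X\rangle\subset A$, $\langle X,X\rangle_D\subset B$ and $$\overline{{}_C\langle X,X\rangle}=A,\quad \overline{\langle X,X\rangle_D}=B,\quad \overline{{}_C\langle Y,X\rangle}=C,\quad \overline{\langle Y,X\rangle_D}=D .$$ A conditional expectation $E^A:C\to A$ is a positive $A$-$A$-bimodule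 linear map with $E^A(a)=a$ for all $a\in A$. Conditional expectations $E^A:C\to A$ and $E^B:D\to B$ are strongly Morita equivalent as bimodule maps with respect to $Y$ and $X$ if $A\subset C$ and $B\subset D$ are strongly Morita equivalent with respect to $Y$ and $X$, and $$\langle z,\,E^A(c)\cdot x\rangle_D=E^B(\langle z,\,c\cdot x\rangle_D)\qquad(c\in C,\ x,z\in X).$$ A representation $\pi:A\to\mathbf B(\mathcal H)$ (a $*$-homomorphism) on a Hilbert space $\mathcal H$ is non-degenerate if $\overline{\pi(A)\mathcal H}=\mathcal H$. For $C^*$-algebras $P,Q$, non-degenerate representations $\pi_P:P\to\mathbf B(\mathcal H)$ and $\pi_Q:Q\to\mathbf B(\mathcal K)$ are strongly Morita equivalent if there are a $P$-$Q$-equivalence bimodule $Z$ and a linear map $\pi_Z:Z\to\mathbf B(\mathcal K,\mathcal H)$ with $$\pi_Z(x)\pi_Z(y)^*=\pi_P({}_P\langle x,y\rangle),\quad \pi_Z(x)^*\pi_Z(y)=\pi_Q(\langle x,y\rangle_Q),\quad \pi_Z(p\cdot x\cdot q)=\pi_P(p)\pi_Z(x)\pi_Q(q)$$ for all $x,y\in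 Z$, $p\in P$, $q\in Q$. A minimal Stinespring representation of a completely positive linear map $\phi:P\to\mathbf B(\mathcal H)$ is a triple $(\pi,V,\mathcal L)$ of a Hilbert space $\mathcal L$, a representation $\pi$ of $P$ on $\mathcal L$ and $V\in\mathbf B(\mathcal H,\mathcal L)$ with $\phi(p)=V^*\pi(p)V$ for all $p\in P$ and $\overline{\pi(P)V\mathcal H}=\mathcal L$. Two completely positive linear maps $\phi:P\to\mathbf B(\mathcal H)$ and $\psi:Q\to\mathbf B(\mathcal K)$ are strongly Morita equivalent if they have minimal Stinespring representations whose representations of $P$ and $Q$ are strongly Morita equivalent. (Minimal Stinespring representations exist exactly for completely positive maps and are unique up to unitary equivalence.) **Theorem.** Let $A\subset C$ and $B\subset D$ be inclusions of $C^*$-algebras with $\overline{AC}=C$ and $\overline{BD}=D$, and let $E^A:C\to A$ and $E^B:D\to B$ be conditional expectations. Assume that $E^A$ and $E^B$ are strongly Morita equivalent as bimodule maps with respect to a $C$-$D$-equivalence bimodule $Y$ and a closed subspace $X$ of $Y$. Then for every non-degenerate representation $\pi_B:B\to\mathbf B(\mathcal K_B)$ there is a non-degenerate representation $\pi_A:A\to\mathbf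 B(\mathcal H_A)$ such that $\pi_A\circ E^A$ and $\pi_B\circ E^B$ are strongly Morita equivalent as completely positive linear maps. -/

import Mathlib

/-- The structure of a `C`-`D`-equivalence bimodule (imprimitivity bimodule) on a complex Banach
space `Y`: a left `C`-action, a right `D`-action (`rsmul d y` is `y · d`), a full left `C`-valued
inner product (linear in the first variable) and a full right `D`-valued inner product (linear in
the second variable), both inducing the norm of `Y`, which satisfy the compatibility relation
`⟨x, y⟩_C · z = x · ⟨y, z⟩_D`. -/
structure EquivalenceBimodule (C D Y : Type*)
    [NonUnitalCStarAlgebra C] [PartialOrder C] [StarOrderedRing C]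
    [NonUnitalCStarAlgebra D] [PartialOrder D] [StarOrderedRing D]
    [NormedAddCommGroup Y] [NormedSpace ℂ Y] [CompleteSpace Y] where
  lsmul : C →ₗ[ℂ] Y →ₗ[ℂ] Y
  rsmul : D →ₗ[ℂ] Y →ₗ[ℂ] Y
  linner : Y →ₗ[ℂ] Y →ₗ⋆[ℂ] C
  rinner : Y →ₗ⋆[ℂ] Y →ₗ[ℂ] D
  lsmul_mul : ∀ c c' y, lsmul (c * c') y = lsmul c (lsmul c' y)
  rsmul_mul : ∀ d d' y, rsmul (d * d') y = rsmul d' (rsmul d y)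
  lsmul_rsmul : ∀ c d y, lsmul c (rsmul d y) = rsmul d (lsmul c y)
  linner_lsmul : ∀ c x y, linner (lsmul c x) y = c * linner x y
  rinner_rsmul : ∀ d x y, rinner x (rsmul d y) = rinner x y * d
  star_linner : ∀ x y, star (linner x y) = linner y x
  star_rinner : ∀ x y, star (rinner x y) = rinner y x
  linner_self_nonneg : ∀ x, 0 ≤ linner x x
  rinner_self_nonneg : ∀ x, 0 ≤ rinner x x
  norm_linner_self : ∀ x, ‖linner x x‖ = ‖x‖ ^ 2
  norm_rinner_self : ∀ x, ‖rinner x x‖ = ‖x‖ ^ 2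
  rinner_lsmul : ∀ c x y, rinner (lsmul c x) y = rinner x (lsmul (star c) y)
  linner_rsmul : ∀ d x y, linner (rsmul d x) y = linner x (rsmul (star d) y)
  linner_lsmul_eq : ∀ x y z, lsmul (linner x y) z = rsmul (rinner y z) x
  linner_full : Dense (Submodule.span ℂ {c : C | ∃ x y, c = linner x y} : Set C)
  rinner_full : Dense (Submodule.span ℂ {d : D | ∃ x y, d = rinner x y} : Set D)

/-- The inclusion `A ⊂ C` is essential: `A C` spans a dense subspace of `C`. -/
def IsEssentialInclusion {C : Type*} [NonUnitalCStarAlgebra C]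
    (A : NonUnitalStarSubalgebra ℂ C) : Prop :=
  Dense (Submodule.span ℂ {z : C | ∃ a ∈ A, ∃ c : C, z = a * c} : Set C)

/-- A conditional expectation of `C` onto the subalgebra `A`: a positive `A`-`A`-bimodule
linear map which is the identity on `A`. -/
structure IsConditionalExpectation {C : Type*} [NonUnitalCStarAlgebra C] [PartialOrder C]
    (A : NonUnitalStarSubalgebra ℂ C) (E : C →ₗ[ℂ] A) : Prop where
  map_coe : ∀ a : A, E (a : C) = a
  map_nonneg : ∀ c : C, 0 ≤ c → 0 ≤ (E c : C)
  map_mul_left : ∀ (a : A) (c : C), E ((a : C) * c) = a * E c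
  map_mul_right : ∀ (c : C) (a : A), E (c * (a : C)) = E c * a

section Bimodule

variable {C D Y : Type*}
  [NonUnitalCStarAlgebra C] [PartialOrder C] [StarOrderedRing C]
  [NonUnitalCStarAlgebra D] [PartialOrder D] [StarOrderedRing D]
  [NormedAddCommGroup Y] [NormedSpace ℂ Y] [CompleteSpace Y]

/-- The inclusions `A ⊂ C` and `B ⊂ D` are strongly Morita equivalent with respect to the
`C`-`D`-equivalence bimodule `Y` (with structure `S`) and its closed subspace `X`. -/
structure InclusionsMoritaEquivalent (S : EquivalenceBimodule C D Y)
    (A : NonUnitalStarSubalgebra ℂ C) (B : NonUnitalStarSubalgebra ℂ D)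
    (X : Submodule ℂ Y) : Prop where
  isClosed : IsClosed (X : Set Y)
  lsmul_mem : ∀ a ∈ A, ∀ x ∈ X, S.lsmul a x ∈ X
  rsmul_mem : ∀ b ∈ B, ∀ x ∈ X, S.rsmul b x ∈ X
  linner_mem : ∀ x ∈ X, ∀ y ∈ X, S.linner x y ∈ A
  rinner_mem : ∀ x ∈ X, ∀ y ∈ X, S.rinner x y ∈ B
  closure_linner :
    closure (Submodule.span ℂ {c : C | ∃ x ∈ X, ∃ y ∈ X, c = S.linner x y} : Set C) = A
  closure_rinner :
    closure (Submodule.span ℂ {d : D | ∃ x ∈ X, ∃ y ∈ X, d = S.rinner x y} : Set D) = B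
  dense_linner :
    Dense (Submodule.span ℂ {c : C | ∃ y : Y, ∃ x ∈ X, c = S.linner y x} : Set C)
  dense_rinner :
    Dense (Submodule.span ℂ {d : D | ∃ y : Y, ∃ x ∈ X, d = S.rinner y x} : Set D)

/-- The bimodule linear maps `φ : C → A` and `ψ : D → B` are strongly Morita equivalent with
respect to `Y` and its closed subspace `X`: the inclusions are, and
`⟨z, φ(c) · x⟩ = ψ(⟨z, c · x⟩)` for all `c ∈ C` and `x, z ∈ X`. -/
structure BimoduleMapsMoritaEquivalent (S : EquivalenceBimodule C D Y)
    {A : NonUnitalStarSubalgebra ℂ C} {B : NonUnitalStarSubalgebra ℂ D}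
    (X : Submodule ℂ Y) (φ : C →ₗ[ℂ] A) (ψ : D →ₗ[ℂ] B) : Prop where
  inclusions : InclusionsMoritaEquivalent S A B X
  rinner_map : ∀ c : C, ∀ x ∈ X, ∀ z ∈ X,
    S.rinner z (S.lsmul (φ c : C) x) = (ψ (S.rinner z (S.lsmul c x)) : D)

end Bimodule

/-- A representation of a *-algebra on a Hilbert space is non-degenerate if the vectors
`π(a) ξ` span a dense subspace. -/
def IsNondegenerateRep {A H : Type*} [NonUnitalRing A] [StarRing A] [Module ℂ A]
    [NormedAddCommGroup H] [InnerProductSpace ℂ H] [CompleteSpace H]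
    (π : A →⋆ₙₐ[ℂ] (H →L[ℂ] H)) : Prop :=
  Dense (Submodule.span ℂ {η : H | ∃ (a : A) (ξ : H), η = π a ξ} : Set H)

section Representations

variable {A B : Type*}
  [NonUnitalCStarAlgebra A] [PartialOrder A] [StarOrderedRing A]
  [NonUnitalCStarAlgebra B] [PartialOrder B] [StarOrderedRing B]
  {H K : Type*}
  [NormedAddCommGroup H] [InnerProductSpace ℂ H] [CompleteSpace H]
  [NormedAddCommGroup K] [InnerProductSpace ℂ K] [CompleteSpace K]

/-- `(πA, πX, πB)` is a representation of the `A`-`B`-equivalence bimodule `X` on the pair of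
Hilbert spaces `(H, K)`. -/
structure IsBimoduleRep {X : Type*}
    [NormedAddCommGroup X] [NormedSpace ℂ X] [CompleteSpace X] (S : EquivalenceBimodule A B X)
    (πA : A →⋆ₙₐ[ℂ] (H →L[ℂ] H)) (πX : X →ₗ[ℂ] (K →L[ℂ] H))
    (πB : B →⋆ₙₐ[ℂ] (K →L[ℂ] K)) : Prop where
  nondegenerate_left : IsNondegenerateRep πA
  nondegenerate_right : IsNondegenerateRep πB
  map_linner : ∀ x y : X, πX x ∘L ContinuousLinearMap.adjoint (πX y) = πA (S.linner x y)
  map_rinner : ∀ x y : X, ContinuousLinearMap.adjoint (πX x) ∘L πX y = πB (S.rinner x y)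
  map_smul : ∀ (a : A) (x : X) (b : B),
    πX (S.lsmul a (S.rsmul b x)) = πA a ∘L πX x ∘L πB b

universe w in
/-- Strong Morita equivalence of non-degenerate representations: some `A`-`B`-equivalence
bimodule has a representation of the form `(πA, πX, πB)`. -/
def RepsMoritaEquivalent
    (πA : A →⋆ₙₐ[ℂ] (H →L[ℂ] H)) (πB : B →⋆ₙₐ[ℂ] (K →L[ℂ] K)) : Prop :=
  ∃ (X : Type w) (_ : NormedAddCommGroup X) (_ : NormedSpace ℂ X) (_ : CompleteSpace X)
    (S : EquivalenceBimodule A B X) (πX : X →ₗ[ℂ] (K →L[ℂ] H)), IsBimoduleRep S πA πX πB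

/-- `(π, V, L)` is a minimal Stinespring representation for `φ`: `φ(a) = V* π(a) V`, and the
vectors `π(a) V ξ` span a dense subspace of `L`. -/
structure IsMinimalStinespring {L : Type*}
    [NormedAddCommGroup L] [InnerProductSpace ℂ L] [CompleteSpace L]
    (φ : A →ₗ[ℂ] (H →L[ℂ] H)) (π : A →⋆ₙₐ[ℂ] (L →L[ℂ] L)) (V : H →L[ℂ] L) : Prop where
  dilation : ∀ a : A, φ a = ContinuousLinearMap.adjoint V ∘L π a ∘L V
  minimal : Dense (Submodule.span ℂ {η : L | ∃ (a : A) (ξ : H), η = π a (V ξ)} : Set L)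

end Representations

universe u

/-- Strong Morita equivalence of completely positive maps `φ : A → B(H)` and `ψ : B → B(K)`:
they have minimal Stinespring representations which are strongly Morita equivalent. (A linear map
has a minimal Stinespring representation if and only if it is completely positive, and that
representation is then unique up to unitary equivalence, so that complete positivity is part of
this relation and the choice of the representations is immaterial.) -/
def CPMapsMoritaEquivalent {A B : Type u}
    [NonUnitalCStarAlgebra A] [PartialOrder A] [StarOrderedRing A]
    [NonUnitalCStarAlgebra B] [PartialOrder B] [StarOrderedRing B]
    {H K : Type u}
    [NormedAddCommGroup H] [InnerProductSpace ℂ H] [CompleteSpace H]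
    [NormedAddCommGroup K] [InnerProductSpace ℂ K] [CompleteSpace K]
    (φ : A →ₗ[ℂ] (H →L[ℂ] H)) (ψ : B →ₗ[ℂ] (K →L[ℂ] K)) : Prop :=
  ∃ (L : Type u) (_ : NormedAddCommGroup L) (_ : InnerProductSpace ℂ L) (_ : CompleteSpace L)
    (πφ : A →⋆ₙₐ[ℂ] (L →L[ℂ] L)) (V : H →L[ℂ] L)
    (M : Type u) (_ : NormedAddCommGroup M) (_ : InnerProductSpace ℂ M) (_ : CompleteSpace M)
    (πψ : B →⋆ₙₐ[ℂ] (M →L[ℂ] M)) (W : K →L[ℂ] M),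
    IsMinimalStinespring φ πφ V ∧ IsMinimalStinespring ψ πψ W ∧
      RepsMoritaEquivalent.{u} πφ πψ

/-! Induce from `B` along `φ = πB ∘ EB`. Let `L = Y ⊗_φ K` and `M = D ⊗_φ K`, the Hilbert spaces
with `⟪x ⊗ ξ, y ⊗ η⟫ = ⟪ξ, φ(⟨x, y⟩) η⟫`, where `D` carries `⟨x, y⟩ = star x * y`. `C` acts on `L`
and `D` on `M`. Sending `y` to the operator `d ⊗ ξ ↦ y·d ⊗ ξ` represents `Y` itself in `B(M, L)`, so
these two representations are strongly Morita equivalent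
(`EquivalenceBimodule.exists_isBimoduleRep`).

It remains to see them as minimal Stinespring representations. For `πB ∘ EB` on `M` this is
`exists_minimalStinespring`. On the other side `H` is the closed span of `X ⊗ K` in `L`, with `A`
acting through `X`. The compression of `c` to `H` is `πA (EA c)`, because `⟨z, EA(c)·x⟩ = EB ⟨z,
c·x⟩`. Minimality comes from `⟨y, x⟩·x' = y·⟨x, x'⟩`: the products `⟨x, x'⟩` span `B` densely and
`πB` is non-degenerate.

Positivity of the inner products needs the matrices `EB ⟨x_i, x_j⟩` to be positive over `B`
(`exists_matrix_eq_star_mul_self`). -/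

open scoped InnerProductSpace TensorProduct

/-! ### Positive matrices over a `C*`-algebra. -/

section MatrixPositivity

variable {B D : Type*} [NonUnitalCStarAlgebra B]
  [NonUnitalCStarAlgebra D] [PartialOrder D] [StarOrderedRing D]

/-- The negative part `star k * k` of a selfadjoint element `a`, which vanishes only if `a` is
positive. -/
theorem exists_negPart_factorization {R : Type*} [NonUnitalCStarAlgebra R] {a : R}
    (ha : IsSelfAdjoint a) :
    ∃ k : R, a * (star k * k) = -(star k * k * (star k * k)) ∧
      (star k * k = 0 → ∃ l, a = star l * l) := by
  let _ : PartialOrder R := CStarAlgebra.spectralOrder R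
  have _ : StarOrderedRing R := CStarAlgebra.spectralOrderedRing R
  obtain ⟨k, hk⟩ := CStarAlgebra.nonneg_iff_eq_star_mul_self.mp (CFC.negPart_nonneg a)
  refine ⟨k, ?_, fun h ↦ ?_⟩
  · rw [← hk]
    nth_rw 1 [← CFC.posPart_sub_negPart a]
    rw [sub_mul, CFC.posPart_mul_negPart, zero_sub]
  · exact CStarAlgebra.nonneg_iff_eq_star_mul_self.mp
      ((CFC.negPart_eq_zero_iff a).mp (hk.trans h))

/-- A selfadjoint matrix over a `C*`-algebra all of whose compressions by columns are positive is
of the form `star k * k`. -/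
theorem exists_matrix_eq_star_mul_self {n : Type*} [Fintype n]
    (ι : B →⋆ₙₐ[ℂ] D) (hι : Function.Injective ι) (m : n → n → B)
    (hsa : ∀ i j, star (m i j) = m j i)
    (hpos : ∀ b : n → B, 0 ≤ ι (∑ i, ∑ j, star (b i) * m i j * b j)) :
    ∃ k : n → n → B, ∀ i j, m i j = ∑ l, star (k l i) * k l j := by
  classical
  let _ : PartialOrder B := CStarAlgebra.spectralOrder B
  have _ : StarOrderedRing B := CStarAlgebra.spectralOrderedRing B
  let M : CStarMatrix n n B := CStarMatrix.ofMatrix m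
  have hM : IsSelfAdjoint M := by
    ext i j
    exact hsa j i
  obtain ⟨k, hMN, hk0⟩ := exists_negPart_factorization hM
  suffices hneg : star k * k = 0 by
    obtain ⟨l, hl⟩ := hk0 hneg
    refine ⟨l, fun i j ↦ ?_⟩
    change M i j = _
    rw [hl, CStarMatrix.mul_apply]
    rfl
  obtain ⟨N, hk⟩ : ∃ N, N = star k * k := ⟨_, rfl⟩
  rw [← hk] at hMN ⊢
  have hNsa : star N = N := by rw [hk, star_mul, star_star]
  -- The diagonal entries on the left are compressions of `M` by the columns of the negative part
  -- `N`, hence nonnegative; those on the right are negatives of sums of squares. So `k * N`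
  -- vanishes, and with it `N * N = star k * (k * N)`.
  have hcomp : star N * (M * N) = -(star (k * N) * (k * N)) := by
    rw [hMN, star_mul, mul_neg, mul_assoc (star N), ← mul_assoc (star k), ← hk]
  have hdiag : ∀ i j, (k * N) i j = 0 := by
    intro i j
    have h1 := hpos (fun l ↦ N l j)
    have h2 : ∑ i, ∑ l, star (N i j) * m i l * N l j =
        -∑ l, star ((k * N) l j) * (k * N) l j := by
      have := congrFun (congrFun hcomp j) j
      have e1 : (star N * (M * N)) j j = ∑ i, ∑ l, star (N i j) * m i l * N l j := by
        rw [CStarMatrix.mul_apply]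
        simp only [CStarMatrix.mul_apply, Finset.mul_sum, mul_assoc]
        rfl
      rw [← e1, this]
      change -((star (k * N) * (k * N)) j j) = _
      rw [CStarMatrix.mul_apply]
      rfl
    rw [h2, map_neg, map_sum, neg_nonneg] at h1
    have h3 : ∀ l ∈ Finset.univ, 0 ≤ ι (star ((k * N) l j) * (k * N) l j) := fun l _ ↦ by
      rw [map_mul, map_star]
      exact star_mul_self_nonneg _
    have h4 := (Finset.sum_eq_zero_iff_of_nonneg h3).mp
      (le_antisymm h1 (Finset.sum_nonneg h3)) i (Finset.mem_univ i)
    rw [map_eq_zero_iff _ hι] at h4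
    exact CStarRing.star_mul_self_eq_zero_iff _ |>.mp h4
  have hkN : k * N = 0 := by
    ext i j
    exact hdiag i j
  have hNN : star N * N = 0 := by
    rw [hNsa]
    nth_rw 1 [hk]
    rw [mul_assoc, hkN, mul_zero]
  exact CStarRing.star_mul_self_eq_zero_iff _ |>.mp hNN

/-- Once `m` is factored as `star k * k`, the form is the sum over `l` of `‖∑ i, π (k l i) (ξ i)‖ ^
2`. -/
theorem re_sum_inner_nonneg_of_matrix_pos {K : Type*} [NormedAddCommGroup K]
    [InnerProductSpace ℂ K] [CompleteSpace K] (π : B →⋆ₙₐ[ℂ] (K →L[ℂ] K))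
    {n : Type*} [Fintype n]
    (ι : B →⋆ₙₐ[ℂ] D) (hι : Function.Injective ι) (m : n → n → B)
    (hsa : ∀ i j, star (m i j) = m j i)
    (hpos : ∀ b : n → B, 0 ≤ ι (∑ i, ∑ j, star (b i) * m i j * b j)) (ξ : n → K) :
    0 ≤ RCLike.re (∑ i, ∑ j, ⟪ξ i, π (m i j) (ξ j)⟫_ℂ) := by
  obtain ⟨k, hk⟩ := exists_matrix_eq_star_mul_self ι hι m hsa hpos
  have h : ∑ i, ∑ j, ⟪ξ i, π (m i j) (ξ j)⟫_ℂ =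
      ∑ l, ⟪∑ i, π (k l i) (ξ i), ∑ j, π (k l j) (ξ j)⟫_ℂ := by
    simp only [hk, map_sum, map_mul, map_star, sum_inner, inner_sum,
      ContinuousLinearMap.star_eq_adjoint, FunLike.coe_sum, Finset.sum_apply,
      FunLike.coe_mul_eq_comp, Function.comp_apply, ContinuousLinearMap.adjoint_inner_right]
    symm
    rw [Finset.sum_congr rfl fun x _ ↦ Finset.sum_comm, Finset.sum_comm]
    exact Finset.sum_congr rfl fun i _ ↦ Finset.sum_comm
  rw [h, map_sum]
  exact Finset.sum_nonneg fun l _ ↦ inner_self_nonneg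

end MatrixPositivity

/-! ### Bounded operators and representations defined on a total family of vectors. -/

section Dilation

variable {K L M : Type*}
  [NormedAddCommGroup K] [InnerProductSpace ℂ K]
  [NormedAddCommGroup L] [InnerProductSpace ℂ L] [NormedAddCommGroup M] [InnerProductSpace ℂ M]
  {Y Z : Type*} [AddCommGroup Y] [Module ℂ Y] [AddCommGroup Z] [Module ℂ Z]

/-- The linear map `y ⊗ ξ ↦ Λ y ξ`. -/
noncomputable def tensorEval (Λ : Y →ₗ[ℂ] (K →L[ℂ] L)) : Y ⊗[ℂ] K →ₗ[ℂ] L :=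
  TensorProduct.lift (ContinuousLinearMap.coeLM ℂ ∘ₗ Λ)

@[simp]
theorem tensorEval_tmul (Λ : Y →ₗ[ℂ] (K →L[ℂ] L)) (y : Y) (ξ : K) :
    tensorEval Λ (y ⊗ₜ ξ) = Λ y ξ := rfl

/-- The vectors `Λ y ξ` span a dense subspace. -/
def TotalFamily (Λ : Y →ₗ[ℂ] (K →L[ℂ] L)) : Prop :=
  Dense (Submodule.span ℂ {η : L | ∃ (y : Y) (ξ : K), η = Λ y ξ} : Set L)

theorem TotalFamily.denseRange {Λ : Y →ₗ[ℂ] (K →L[ℂ] L)} (h : TotalFamily Λ) :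
    DenseRange (tensorEval Λ) := by
  refine Dense.mono ?_ h
  rw [← LinearMap.coe_range, SetLike.coe_subset_coe, Submodule.span_le]
  rintro _ ⟨y, ξ, rfl⟩
  exact ⟨y ⊗ₜ ξ, rfl⟩

theorem TotalFamily.ext {Λ : Y →ₗ[ℂ] (K →L[ℂ] L)} (h : TotalFamily Λ) {S T : L →L[ℂ] M}
    (hST : ∀ y ξ, S (Λ y ξ) = T (Λ y ξ)) : S = T :=
  ContinuousLinearMap.ext_on h (by rintro _ ⟨y, ξ, rfl⟩; exact hST y ξ)

theorem TotalFamily.ext_inner {Λ : Y →ₗ[ℂ] (K →L[ℂ] L)} (h : TotalFamily Λ) {u v : L}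
    (huv : ∀ y ξ, ⟪Λ y ξ, u⟫_ℂ = ⟪Λ y ξ, v⟫_ℂ) : u = v := by
  have : innerSL ℂ u = innerSL ℂ v := h.ext fun y ξ ↦ by
    simp only [innerSL_apply_apply]
    rw [← inner_conj_symm, huv, inner_conj_symm]
  exact (innerSL_inj).mp this

/-- A map of generators which is dominated by a bounded operator extends to a bounded operator. -/
theorem TotalFamily.exists_extension [CompleteSpace M] {Λ : Y →ₗ[ℂ] (K →L[ℂ] L)} (h : TotalFamily Λ)
    (Λ' : Z →ₗ[ℂ] (K →L[ℂ] M)) (R : Y →ₗ[ℂ] Z) (P : L →L[ℂ] L)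
    (hP : ∀ a b ξ η, ⟪Λ' (R a) ξ, Λ' (R b) η⟫_ℂ = ⟪Λ a ξ, P (Λ b η)⟫_ℂ) :
    ∃ T : L →L[ℂ] M, ∀ y ξ, T (Λ y ξ) = Λ' (R y) ξ := by
  have hin : ∀ v w, ⟪tensorEval (Λ' ∘ₗ R) v, tensorEval (Λ' ∘ₗ R) w⟫_ℂ =
      ⟪tensorEval Λ v, P (tensorEval Λ w)⟫_ℂ := by
    intro v w
    induction v with
    | zero => simp
    | add v₁ v₂ h₁ h₂ => simp only [map_add, inner_add_left, h₁, h₂]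
    | tmul a ξ =>
      induction w with
      | zero => simp
      | add w₁ w₂ h₁ h₂ => simp only [map_add, inner_add_right, h₁, h₂]
      | tmul b η => exact hP a b ξ η
  have hbound : ∀ v, ‖tensorEval (Λ' ∘ₗ R) v‖ ≤ √‖P‖ * ‖tensorEval Λ v‖ := by
    intro v
    refine le_of_sq_le_sq ?_ (by positivity)
    rw [mul_pow, Real.sq_sqrt (norm_nonneg P), ← inner_self_eq_norm_sq (𝕜 := ℂ), hin]
    calc _ ≤ ‖tensorEval Λ v‖ * ‖P (tensorEval Λ v)‖ := re_inner_le_norm _ _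
      _ ≤ ‖tensorEval Λ v‖ * (‖P‖ * ‖tensorEval Λ v‖) := by gcongr; exact P.le_opNorm _
      _ = _ := by ring
  refine ⟨(tensorEval (Λ' ∘ₗ R)).extendOfNorm (tensorEval Λ), fun y ξ ↦ ?_⟩
  exact LinearMap.extendOfNorm_eq h.denseRange ⟨_, hbound⟩ (y ⊗ₜ ξ)

/-- An action of a `C*`-algebra by adjointable operators on a dense subspace of a Hilbert space
extends to a representation. -/
theorem exists_rep_of_denseRange [CompleteSpace L] {C V : Type*} [NonUnitalCStarAlgebra C] [AddCommGroup V]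
    [Module ℂ V] (ρ : C →ₙₐ[ℂ] Module.End ℂ V) (q : V →ₗ[ℂ] L) (hq : DenseRange q)
    (hρ : ∀ c v w, ⟪q (ρ c v), q w⟫_ℂ = ⟪q v, q (ρ (star c) w)⟫_ℂ) :
    ∃ π : C →⋆ₙₐ[ℂ] (L →L[ℂ] L), ∀ c v, π c (q v) = q (ρ c v) := by
  -- The bound `‖q (ρ c v)‖ ≤ ‖c‖ * ‖q v‖` comes from factoring `‖c‖ ^ 2 - star c * c` as `star k *
  -- k`, which takes place in the unitization.
  let ρ' := Unitization.lift ρ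
  have hρ' : ∀ u v w, ⟪q (ρ' u v), q w⟫_ℂ = ⟪q v, q (ρ' (star u) w)⟫_ℂ := by
    intro u v w
    induction u with
    | inl_add_inr z c =>
      simp [ρ', hρ, Module.algebraMap_end_apply, mul_comm]
  let _ : PartialOrder (Unitization ℂ C) := CStarAlgebra.spectralOrder _
  have _ : StarOrderedRing (Unitization ℂ C) := CStarAlgebra.spectralOrderedRing _
  have hbound : ∀ c v, ‖(q ∘ₗ ρ c) v‖ ≤ ‖c‖ * ‖q v‖ := by
    intro c v
    have h1 := CStarAlgebra.star_mul_le_algebraMap_norm_sq (a := (c : Unitization ℂ C))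
    rw [← sub_nonneg] at h1
    obtain ⟨k, hk⟩ := CStarAlgebra.nonneg_iff_eq_star_mul_self.mp h1
    have h2 : ⟪q (ρ' k v), q (ρ' k v)⟫_ℂ =
        ⟪q v, ((‖c‖ ^ 2 : ℝ) : ℂ) • q v⟫_ℂ - ⟪q (ρ c v), q (ρ c v)⟫_ℂ := by
      have h3 : ρ c v = ρ' (c : Unitization ℂ C) v := by simp [ρ']
      rw [hρ', ← Module.End.mul_apply, ← map_mul, ← hk, h3, hρ', ← inner_sub_right,
        ← Module.End.mul_apply, ← map_mul, map_sub, LinearMap.sub_apply, map_sub,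
        Unitization.norm_inr, IsScalarTower.algebraMap_apply ℝ ℂ, AlgHom.commutes,
        Module.algebraMap_end_apply, map_smul]
      rfl
    refine le_of_sq_le_sq ?_ (by positivity)
    have h4 := inner_self_nonneg (𝕜 := ℂ) (x := q (ρ' k v))
    rw [h2, inner_smul_right, map_sub, inner_self_eq_norm_sq (𝕜 := ℂ),
      ← RCLike.ofReal_eq_complex_ofReal, RCLike.re_ofReal_mul, inner_self_eq_norm_sq (𝕜 := ℂ)] at h4
    rw [mul_pow]
    simpa using h4
  let T : C → (L →L[ℂ] L) := fun c ↦ (q ∘ₗ ρ c).extendOfNorm q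
  have hT : ∀ c v, T c (q v) = q (ρ c v) := fun c v ↦
    LinearMap.extendOfNorm_eq hq ⟨_, hbound c⟩ v
  have hext : ∀ {S S' : L →L[ℂ] L}, (∀ v, S (q v) = S' (q v)) → S = S' := fun {S S'} h ↦
    ContinuousLinearMap.ext fun x ↦ congrFun (hq.equalizer S.continuous S'.continuous
      (funext h)) x
  refine ⟨{ toFun := T
            map_smul' := fun z c ↦ hext fun v ↦ by simp [hT]
            map_zero' := hext fun v ↦ by simp [hT]
            map_add' := fun c c' ↦ hext fun v ↦ by simp [hT]
            map_mul' := fun c c' ↦ hext fun v ↦ by simp [hT]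
            map_star' := fun c ↦ hext fun v ↦ hq.eq_of_inner_left ℂ fun w ↦ ?_ }, hT⟩
  rw [hT, ContinuousLinearMap.star_eq_adjoint, ContinuousLinearMap.adjoint_inner_left, hT, hρ,
    star_star]

/-- An action on the generators by adjointable maps gives rise to a representation. -/
theorem TotalFamily.exists_rep [CompleteSpace L] {C : Type*} [NonUnitalCStarAlgebra C]
    {Λ : Y →ₗ[ℂ] (K →L[ℂ] L)} (h : TotalFamily Λ) (act : C →ₗ[ℂ] Y →ₗ[ℂ] Y)
    (hmul : ∀ c c' y, act (c * c') y = act c (act c' y))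
    (hadj : ∀ c y y' ξ η, ⟪Λ (act c y) ξ, Λ y' η⟫_ℂ = ⟪Λ y ξ, Λ (act (star c) y') η⟫_ℂ) :
    ∃ π : C →⋆ₙₐ[ℂ] (L →L[ℂ] L), ∀ c y ξ, π c (Λ y ξ) = Λ (act c y) ξ := by
  let ρ : C →ₙₐ[ℂ] Module.End ℂ (Y ⊗[ℂ] K) :=
    { toFun := fun c ↦ LinearMap.rTensor K (act c)
      map_smul' := fun z c ↦ by simp [LinearMap.rTensor_smul]
      map_zero' := by simp
      map_add' := fun c c' ↦ by simp [LinearMap.rTensor_add]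
      map_mul' := fun c c' ↦ by
        rw [← LinearMap.rTensor_mul]
        congr 1
        ext y
        exact hmul c c' y }
  obtain ⟨π, hπ⟩ := exists_rep_of_denseRange ρ (tensorEval Λ) h.denseRange (fun c v w ↦ by
    induction v with
    | zero => simp
    | add v₁ v₂ h₁ h₂ => simp only [map_add, inner_add_left, h₁, h₂]
    | tmul a ξ =>
      induction w with
      | zero => simp
      | add w₁ w₂ h₁ h₂ => simp only [map_add, inner_add_right, h₁, h₂]
      | tmul b η => exact hadj c a b ξ η)
  exact ⟨π, fun c y ξ ↦ hπ c (y ⊗ₜ ξ)⟩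

end Dilation

/-! ### Hilbert spaces from positive kernels. -/

/-- Kolmogorov decomposition of a positive operator valued sesquilinear kernel. -/
theorem exists_kolmogorov.{u₁, u₂} {Y : Type u₁} {K : Type u₂} [AddCommGroup Y] [Module ℂ Y]
    [NormedAddCommGroup K] [InnerProductSpace ℂ K] [CompleteSpace K]
    (G : Y → Y →ₗ[ℂ] (K →L[ℂ] K)) (hG : ∀ x y, star (G x y) = G y x)
    (hpos : ∀ (s : Finset Y) (ξ : Y → K),
      0 ≤ RCLike.re (∑ i : s, ∑ j : s, ⟪ξ i, G i j (ξ j)⟫_ℂ)) :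
    ∃ (L : Type (max u₁ u₂)) (_ : NormedAddCommGroup L) (_ : InnerProductSpace ℂ L)
      (_ : CompleteSpace L) (Λ : Y →ₗ[ℂ] (K →L[ℂ] L)), TotalFamily Λ ∧
        ∀ x y ξ η, ⟪Λ x ξ, Λ y η⟫_ℂ = ⟪ξ, G x y η⟫_ℂ := by
  let k : Matrix Y Y (K →L[ℂ] K) := Matrix.of fun x y ↦ G x y
  have hk : k.PosSemidef := by
    have h : k.IsHermitian ∧ ∀ (f : Y →₀ K),
        0 ≤ RCLike.re (f.sum fun x w ↦ f.sum fun x' w' ↦ ⟪k x' x w, w'⟫_ℂ) := by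
      refine ⟨Matrix.ext fun x y ↦ hG y x, fun f ↦ ?_⟩
      convert hpos f.support f using 1
      have hin : ∀ x y, ⟪k y x (f x), f y⟫_ℂ = ⟪f x, G x y (f y)⟫_ℂ := fun x y ↦ by
        rw [← hG y x, ContinuousLinearMap.star_eq_adjoint, ContinuousLinearMap.adjoint_inner_right]
        rfl
      simp only [Finsupp.sum, hin]
      rw [← Finset.sum_coe_sort]
      exact congrArg _ (Finset.sum_congr rfl fun x _ ↦ (Finset.sum_coe_sort f.support
        fun y ↦ ⟪f x, G x y (f y)⟫_ℂ).symm)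
    exact ((RKHS.posSemidef_tfae (K := k)).out 0 2).mpr h
  have _ : Fact k.PosSemidef := ⟨hk⟩
  have hin : ∀ x y ξ η, ⟪RKHS.kerFun (RKHS.OfKernel k) x ξ, RKHS.kerFun (RKHS.OfKernel k) y η⟫_ℂ =
      ⟪ξ, G x y η⟫_ℂ := fun x y ξ η ↦ by
    rw [RKHS.kerFun_inner, RKHS.kerFun_apply, RKHS.OfKernel.kernel_ofKernel]
    rfl
  have hdense := RKHS.kerFun_dense (RKHS.OfKernel k)
  have hext : ∀ u v : RKHS.OfKernel k, (∀ x ξ, ⟪RKHS.kerFun (RKHS.OfKernel k) x ξ, u⟫_ℂ =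
      ⟪RKHS.kerFun (RKHS.OfKernel k) x ξ, v⟫_ℂ) → u = v := fun u v h ↦
    RKHS.ext fun x ↦ ext_inner_left ℂ fun ξ ↦ by simpa using h x ξ
  -- The kernel is linear in its second variable, and vectors are determined by their inner products
  -- with the kernel functions; this forces linearity in the index.
  let Λ : Y →ₗ[ℂ] (K →L[ℂ] RKHS.OfKernel k) :=
    { toFun := RKHS.kerFun (RKHS.OfKernel k)
      map_add' := fun x y ↦ ContinuousLinearMap.ext fun ξ ↦ hext _ _ fun z η ↦ by
        rw [add_apply, inner_add_right, hin, hin, hin, map_add, add_apply, inner_add_right]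
      map_smul' := fun c x ↦ ContinuousLinearMap.ext fun ξ ↦ hext _ _ fun z η ↦ by
        rw [smul_apply, inner_smul_right, hin, hin, map_smul, smul_apply,
          inner_smul_right]
        rfl }
  refine ⟨RKHS.OfKernel k, inferInstance, inferInstance, inferInstance, Λ, ?_, hin⟩
  rw [TotalFamily, Submodule.dense_iff_topologicalClosure_eq_top, ← hdense]
  congr 2
  ext η
  simp [Λ, eq_comm]

/-! ### Interior tensor products along `π ∘ E`. -/

namespace IsConditionalExpectation

variable {D : Type*} [NonUnitalCStarAlgebra D] [PartialOrder D] [StarOrderedRing D]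
  {B : NonUnitalStarSubalgebra ℂ D} {E : D →ₗ[ℂ] B}

theorem map_star (hE : IsConditionalExpectation B E) (d : D) : E (star d) = star (E d) := by
  let F : D →ₚ[ℂ] D :=
    { toLinearMap := B.toNonUnitalSubalgebra.toSubmodule.subtype ∘ₗ E
      monotone' := fun a b hab ↦ by
        have h := hE.map_nonneg (b - a) (sub_nonneg.mpr hab)
        rw [map_sub] at h
        exact sub_nonneg.mp h }
  exact Subtype.ext (StarHomClass.map_star F d)

/-- The interior tensor product of a right Hilbert module with a Hilbert space along the completely
positive map `π ∘ E`, for a conditional expectation `E` and a representation `π` of its range. -/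
theorem exists_dilation {D Y K : Type u}
    [NonUnitalCStarAlgebra D] [PartialOrder D] [StarOrderedRing D]
    {B : NonUnitalStarSubalgebra ℂ D} (hB : IsClosed (B : Set D)) {E : D →ₗ[ℂ] B}
    (hE : IsConditionalExpectation B E)
    [AddCommGroup Y] [Module ℂ Y]
    [NormedAddCommGroup K] [InnerProductSpace ℂ K] [CompleteSpace K]
    (π : B →⋆ₙₐ[ℂ] (K →L[ℂ] K))
    (act : D →ₗ[ℂ] Y →ₗ[ℂ] Y) (r : Y →ₗ⋆[ℂ] Y →ₗ[ℂ] D)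
    (hact : ∀ d x y, r x (act d y) = r x y * d) (hstar : ∀ x y, star (r x y) = r y x)
    (hpos : ∀ x, 0 ≤ r x x) :
    ∃ (L : Type u) (_ : NormedAddCommGroup L) (_ : InnerProductSpace ℂ L)
      (_ : CompleteSpace L) (Λ : Y →ₗ[ℂ] (K →L[ℂ] L)), TotalFamily Λ ∧
        (∀ x y ξ η, ⟪Λ x ξ, Λ y η⟫_ℂ = ⟪ξ, π (E (r x y)) η⟫_ℂ) ∧
        ∀ (b : B) y ξ, Λ (act b y) ξ = Λ y (π b ξ) := by
  have _ : IsClosed (B : Set D) := hB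
  let G : Y → Y →ₗ[ℂ] (K →L[ℂ] K) := fun x ↦ (π : B →ₗ[ℂ] (K →L[ℂ] K)) ∘ₗ E ∘ₗ r x
  have hG : ∀ x y, star (G x y) = G y x := fun x y ↦ by
    change star (π (E (r x y))) = π (E (r y x))
    rw [← StarHomClass.map_star, ← hE.map_star, hstar]
  obtain ⟨L, i₁, i₂, i₃, Λ, hΛ, hin⟩ := exists_kolmogorov G hG fun s ξ ↦ by
    refine re_sum_inner_nonneg_of_matrix_pos (D := D) π (n := s)
      (NonUnitalStarSubalgebraClass.subtype B) Subtype.val_injective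
      (fun i j ↦ E (r i j)) (fun i j ↦ by rw [← hE.map_star, hstar]) (fun b ↦ ?_)
      (fun i ↦ ξ i)
    have hstar_act : ∀ (d : D) x y, r (act d x) y = star d * r x y := fun d x y ↦ by
      rw [← hstar, hact, star_mul, hstar]
    -- By the bimodule property the compression of the matrix `E (r i j)` by the column `b` is `E (r
    -- v v)` with `v = ∑ i, i·b i`. Thus positivity of `E` alone suffices, without complete
    -- positivity.
    have h := hE.map_nonneg _ (hpos (∑ i : s, act (b i) i))
    convert h using 1
    change ((∑ i : s, ∑ j : s, star (b i) * E (r i j) * b j : B) : D) = _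
    congr 1
    simp only [map_sum, LinearMap.sum_apply, hact, hstar_act, hE.map_mul_right]
    rw [Finset.sum_comm]
    refine Finset.sum_congr rfl fun i _ ↦ Finset.sum_congr rfl fun j _ ↦ ?_
    rw [← hE.map_mul_left]
    rfl
  refine ⟨L, i₁, i₂, i₃, Λ, hΛ, hin, fun b y ξ ↦ hΛ.ext_inner fun x η ↦ ?_⟩
  rw [hin, hin]
  change ⟪η, π (E (r x (act b y))) ξ⟫_ℂ = ⟪η, π (E (r x y)) (π b ξ)⟫_ℂ
  rw [hact, hE.map_mul_right, map_mul]
  rfl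

end IsConditionalExpectation

/-! ### Closed subspaces and density. -/

/-- Restriction of a total family to a subspace of its parameters. -/
theorem exists_restricted_family {Y K L : Type u} [AddCommGroup Y] [Module ℂ Y]
    [NormedAddCommGroup K] [InnerProductSpace ℂ K]
    [NormedAddCommGroup L] [InnerProductSpace ℂ L] [CompleteSpace L]
    (Λ : Y →ₗ[ℂ] (K →L[ℂ] L)) (X : Submodule ℂ Y) :
    ∃ (H : Type u) (_ : NormedAddCommGroup H) (_ : InnerProductSpace ℂ H) (_ : CompleteSpace H)
      (Γ : X →ₗ[ℂ] (K →L[ℂ] H)) (V : H →ₗᵢ[ℂ] L), TotalFamily Γ ∧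
        ∀ x ξ, V (Γ x ξ) = Λ x ξ := by
  let P : Submodule ℂ L := Submodule.span ℂ {η | ∃ (x : X) (ξ : K), η = Λ x ξ}
  let H : Submodule ℂ L := P.topologicalClosure
  have hmem : ∀ (x : X) ξ, Λ x ξ ∈ H := fun x ξ ↦
    P.le_topologicalClosure (Submodule.subset_span ⟨x, ξ, rfl⟩)
  have _ : CompleteSpace H := P.isClosed_topologicalClosure.completeSpace_coe
  let Γ : X →ₗ[ℂ] (K →L[ℂ] H) :=
    { toFun := fun x ↦ (Λ x).codRestrict H (hmem x)
      map_add' := fun x y ↦ by ext ξ; simp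
      map_smul' := fun c x ↦ by ext ξ; simp }
  refine ⟨H, inferInstance, inferInstance, inferInstance, Γ, H.subtypeₗᵢ, ?_, fun _ _ ↦ rfl⟩
  refine Subtype.dense_iff.mpr (closure_mono ?_)
  change (P : Set L) ⊆ H.subtype '' _
  rw [← Submodule.map_coe, SetLike.coe_subset_coe, Submodule.span_le]
  rintro _ ⟨x, ξ, rfl⟩
  exact ⟨Γ x ξ, Submodule.subset_span ⟨x, ξ, rfl⟩, rfl⟩

/-- A closed subspace which contains the vectors `f (π b ξ)`, for `b` in a spanning subset, contains
the range of `f`. -/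
theorem mem_of_forall_generator_mem {D K L : Type*} [NonUnitalCStarAlgebra D]
    {B : NonUnitalStarSubalgebra ℂ D} (hB : IsClosed (B : Set D))
    [NormedAddCommGroup K] [InnerProductSpace ℂ K] [CompleteSpace K]
    [NormedAddCommGroup L] [InnerProductSpace ℂ L]
    {π : B →⋆ₙₐ[ℂ] (K →L[ℂ] K)} (hπ : IsNondegenerateRep π) {s : Set D}
    (hs : closure (Submodule.span ℂ s : Set D) = B) (f : K →L[ℂ] L) {W : Submodule ℂ L}
    (hW : IsClosed (W : Set L)) (h : ∀ b : B, (b : D) ∈ s → ∀ ξ, f (π b ξ) ∈ W) (ξ : K) :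
    f ξ ∈ W := by
  have _ : IsClosed (B : Set D) := hB
  have hcont : Continuous π :=
    AddMonoidHomClass.continuous_of_bound π 1 fun b ↦ by
      simpa using NonUnitalStarAlgHom.norm_apply_le π b
  have key : ∀ (b : B) ξ, f (π b ξ) ∈ W := by
    intro b ξ
    -- For fixed `ξ` the good `b` form a subspace, closed because `π` is contractive; it contains
    -- the generators, hence is all of `B`.
    let T : Submodule ℂ B :=
      { carrier := {b | f (π b ξ) ∈ W}
        add_mem' := fun {b c} hb hc ↦ by
          simpa using W.add_mem hb hc
        zero_mem' := by simp
        smul_mem' := fun c b hb ↦ by simpa using W.smul_mem c hb }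
    have hT : IsClosed (T : Set B) :=
      hW.preimage (f.continuous.comp (hcont.clm_apply continuous_const))
    have hsB : s ⊆ B := Submodule.subset_span.trans (subset_closure.trans hs.subset)
    have hsT : Submodule.span ℂ s ≤ T.map B.toNonUnitalSubalgebra.toSubmodule.subtype :=
      Submodule.span_le.mpr fun d hd ↦ ⟨⟨d, hsB hd⟩, h ⟨d, hsB hd⟩ hd ξ, rfl⟩
    have hb : b ∈ closure (T : Set B) := by
      rw [closure_subtype]
      exact closure_mono hsT (hs.symm.subset b.2)
    exact hT.closure_eq.subset hb
  have hW' : IsClosed ((W.comap (f : K →ₗ[ℂ] L) : Submodule ℂ K) : Set K) :=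
    hW.preimage f.continuous
  have hspan : Submodule.span ℂ {η : K | ∃ (b : B) (ξ : K), η = π b ξ} ≤
      W.comap (f : K →ₗ[ℂ] L) := by
    rw [Submodule.span_le]
    rintro _ ⟨b, η, rfl⟩
    exact key b η
  exact hW'.closure_subset_iff.mpr hspan (hπ ξ)

theorem TotalFamily.dense_of_forall_mem {Y K L : Type*} [AddCommGroup Y] [Module ℂ Y]
    [NormedAddCommGroup K] [InnerProductSpace ℂ K] [NormedAddCommGroup L] [InnerProductSpace ℂ L]
    {Λ : Y →ₗ[ℂ] (K →L[ℂ] L)} (h : TotalFamily Λ) {W : Submodule ℂ L}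
    (hW : ∀ y ξ, Λ y ξ ∈ W.topologicalClosure) : Dense (W : Set L) := by
  rw [Submodule.dense_iff_topologicalClosure_eq_top, eq_top_iff,
    ← (Submodule.dense_iff_topologicalClosure_eq_top).mp h]
  refine Submodule.topologicalClosure_minimal _ ?_ W.isClosed_topologicalClosure
  rw [Submodule.span_le]
  rintro _ ⟨y, ξ, rfl⟩
  exact hW y ξ

theorem IsMinimalStinespring.isNondegenerateRep {A H L : Type*}
    [NonUnitalCStarAlgebra A] [PartialOrder A] [StarOrderedRing A]
    [NormedAddCommGroup H] [InnerProductSpace ℂ H] [CompleteSpace H]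
    [NormedAddCommGroup L] [InnerProductSpace ℂ L] [CompleteSpace L]
    {φ : A →ₗ[ℂ] (H →L[ℂ] H)} {π : A →⋆ₙₐ[ℂ] (L →L[ℂ] L)} {V : H →L[ℂ] L}
    (h : IsMinimalStinespring φ π V) : IsNondegenerateRep π :=
  h.minimal.mono (Submodule.span_mono (by rintro _ ⟨a, ξ, rfl⟩; exact ⟨a, V ξ, rfl⟩))

/-! ### Stinespring and bimodule representations on the tensor products. -/

/-- The minimal Stinespring representation of `π ∘ E`, for a conditional expectation `E`. -/
theorem IsConditionalExpectation.exists_minimalStinespring {D K M : Type u}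
    [NonUnitalCStarAlgebra D] [PartialOrder D] [StarOrderedRing D]
    {B : NonUnitalStarSubalgebra ℂ D} {E : D →ₗ[ℂ] B} (hE : IsConditionalExpectation B E)
    [NormedAddCommGroup K] [InnerProductSpace ℂ K] [CompleteSpace K]
    [NormedAddCommGroup M] [InnerProductSpace ℂ M] [CompleteSpace M]
    {π : B →⋆ₙₐ[ℂ] (K →L[ℂ] K)} (hπ : IsNondegenerateRep π)
    {Θ : D →ₗ[ℂ] (K →L[ℂ] M)} (hΘ : TotalFamily Θ)
    (hin : ∀ x y ξ η, ⟪Θ x ξ, Θ y η⟫_ℂ = ⟪ξ, π (E (star x * y)) η⟫_ℂ)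
    (hbal : ∀ (b : B) d ξ, Θ (d * b) ξ = Θ d (π b ξ))
    {πD : D →⋆ₙₐ[ℂ] (M →L[ℂ] M)} (hπD : ∀ c d ξ, πD c (Θ d ξ) = Θ (c * d) ξ) :
    ∃ V : K →L[ℂ] M, IsMinimalStinespring ((π : B →ₗ[ℂ] (K →L[ℂ] K)) ∘ₗ E) πD V := by
  have hπ' : TotalFamily (π : B →ₗ[ℂ] (K →L[ℂ] K)) := hπ
  -- Without a unit `V ξ = Θ 1 ξ` is not available, so `V` is defined by `π b ξ ↦ Θ b ξ`. Since `E`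
  -- fixes `B`, this preserves inner products, whence the dominating operator `1`.
  obtain ⟨V, hV⟩ := hπ'.exists_extension Θ B.toNonUnitalSubalgebra.toSubmodule.subtype 1
    fun a b ξ η ↦ by
      change ⟪Θ (a : D) ξ, Θ (b : D) η⟫_ℂ = ⟪π a ξ, π b η⟫_ℂ
      rw [hin, ← ContinuousLinearMap.adjoint_inner_right, ← ContinuousLinearMap.star_eq_adjoint,
        ← StarHomClass.map_star, ← mul_apply_eq_comp, ← map_mul]
      exact congrArg (fun b ↦ ⟪ξ, π b η⟫_ℂ) (hE.map_coe (star a * b))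
  replace hV : ∀ (b : B) ξ, V (π b ξ) = Θ (b : D) ξ := hV
  have hΘV : ∀ d ξ, Θ d ξ = πD d (V ξ) := by
    intro d
    refine DFunLike.congr_fun (hπ'.ext (S := Θ d) (T := πD d ∘L V) fun b ξ ↦ ?_)
    change Θ d (π b ξ) = πD d (V (π b ξ))
    rw [hV, hπD, hbal]
  refine ⟨V, fun d ↦ ContinuousLinearMap.ext fun ξ ↦ hπ'.ext_inner fun b η ↦ ?_, ?_⟩
  · change ⟪π b η, π (E d) ξ⟫_ℂ = ⟪π b η, ContinuousLinearMap.adjoint V (πD d (V ξ))⟫_ℂ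
    rw [ContinuousLinearMap.adjoint_inner_right, hV, ← hΘV, hin,
      ← ContinuousLinearMap.adjoint_inner_right, ← ContinuousLinearMap.star_eq_adjoint,
      ← StarHomClass.map_star, ← mul_apply_eq_comp, ← map_mul, ← hE.map_mul_left]
    rfl
  · simp only [← hΘV]
    exact hΘ

/-- The representation of an equivalence bimodule `Y` between its interior tensor products. -/
theorem EquivalenceBimodule.exists_isBimoduleRep {C D Y K L M : Type*}
    [NonUnitalCStarAlgebra C] [PartialOrder C] [StarOrderedRing C]
    [NonUnitalCStarAlgebra D] [PartialOrder D] [StarOrderedRing D]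
    [NormedAddCommGroup Y] [NormedSpace ℂ Y] [CompleteSpace Y] (S : EquivalenceBimodule C D Y)
    [NormedAddCommGroup K] [InnerProductSpace ℂ K]
    [NormedAddCommGroup L] [InnerProductSpace ℂ L] [CompleteSpace L]
    [NormedAddCommGroup M] [InnerProductSpace ℂ M] [CompleteSpace M]
    {φ : D → (K →L[ℂ] K)} {Λ : Y →ₗ[ℂ] (K →L[ℂ] L)} (hΛ : TotalFamily Λ)
    (hΛin : ∀ x y ξ η, ⟪Λ x ξ, Λ y η⟫_ℂ = ⟪ξ, φ (S.rinner x y) η⟫_ℂ)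
    {Θ : D →ₗ[ℂ] (K →L[ℂ] M)} (hΘ : TotalFamily Θ)
    (hΘin : ∀ x y ξ η, ⟪Θ x ξ, Θ y η⟫_ℂ = ⟪ξ, φ (star x * y) η⟫_ℂ)
    {πC : C →⋆ₙₐ[ℂ] (L →L[ℂ] L)} (hπC : ∀ c y ξ, πC c (Λ y ξ) = Λ (S.lsmul c y) ξ)
    {πD : D →⋆ₙₐ[ℂ] (M →L[ℂ] M)} (hπD : ∀ c d ξ, πD c (Θ d ξ) = Θ (c * d) ξ)
    (hC : IsNondegenerateRep πC) (hD : IsNondegenerateRep πD) :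
    ∃ πY : Y →ₗ[ℂ] (M →L[ℂ] L), IsBimoduleRep S πC πY πD := by
  have rinner_rsmul_left : ∀ d x y, S.rinner (S.rsmul d x) y = star d * S.rinner x y :=
    fun d x y ↦ by rw [← S.star_rinner, S.rinner_rsmul, star_mul, S.star_rinner]
  -- The operator `πD ⟨y, y⟩` is what `star T * T` must be, and it supplies the bound.
  have hex : ∀ y : Y, ∃ T : M →L[ℂ] L, ∀ d ξ, T (Θ d ξ) = Λ (S.rsmul d y) ξ := fun y ↦
    hΘ.exists_extension Λ (S.rsmul.flip y) (πD (S.rinner y y)) fun a b ξ η ↦ by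
      rw [hπD, hΘin, LinearMap.flip_apply, LinearMap.flip_apply, hΛin, S.rinner_rsmul,
        rinner_rsmul_left, mul_assoc]
  choose T hT using hex
  let πY : Y →ₗ[ℂ] (M →L[ℂ] L) :=
    { toFun := T
      map_add' := fun x y ↦ hΘ.ext fun d ξ ↦ by simp [hT]
      map_smul' := fun c y ↦ hΘ.ext fun d ξ ↦ by simp [hT] }
  have hadj : ∀ y z ξ, ContinuousLinearMap.adjoint (T y) (Λ z ξ) = Θ (S.rinner y z) ξ :=
    fun y z ξ ↦ hΘ.ext_inner fun d η ↦ by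
      rw [ContinuousLinearMap.adjoint_inner_right, hT, hΛin, hΘin, rinner_rsmul_left]
  refine ⟨πY, hC, hD, fun x y ↦ hΛ.ext fun z ξ ↦ ?_, fun x y ↦ hΘ.ext fun d ξ ↦ ?_,
    fun a x b ↦ hΘ.ext fun d ξ ↦ ?_⟩
  · change T x (ContinuousLinearMap.adjoint (T y) (Λ z ξ)) = _
    rw [hadj, hT, hπC, S.linner_lsmul_eq]
  · change ContinuousLinearMap.adjoint (T x) (T y (Θ d ξ)) = _
    rw [hT, hadj, hπD, S.rinner_rsmul]
  · change T _ (Θ d ξ) = πC a (T x (πD b (Θ d ξ)))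
    rw [hπD, hT, hT, hπC, S.rsmul_mul, S.lsmul_rsmul, S.lsmul_rsmul, S.lsmul_rsmul]

/-! ### The main theorem. -/

theorem theorem5p7 {C D Y : Type u}
    [NonUnitalCStarAlgebra C] [PartialOrder C] [StarOrderedRing C]
    [NonUnitalCStarAlgebra D] [PartialOrder D] [StarOrderedRing D]
    [NormedAddCommGroup Y] [NormedSpace ℂ Y] [CompleteSpace Y]
    (A : NonUnitalStarSubalgebra ℂ C) (hA : IsClosed (A : Set C)) (hAC : IsEssentialInclusion A)
    (B : NonUnitalStarSubalgebra ℂ D) (hB : IsClosed (B : Set D)) (hBD : IsEssentialInclusion B)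
    (EA : C →ₗ[ℂ] A) (hEA : IsConditionalExpectation A EA)
    (EB : D →ₗ[ℂ] B) (hEB : IsConditionalExpectation B EB)
    (S : EquivalenceBimodule C D Y) (X : Submodule ℂ Y)
    (hE : BimoduleMapsMoritaEquivalent S X EA EB)
    (K : Type u) [NormedAddCommGroup K] [InnerProductSpace ℂ K] [CompleteSpace K]
    (πB : B →⋆ₙₐ[ℂ] (K →L[ℂ] K)) (hπB : IsNondegenerateRep πB) :
    ∃ (H : Type u) (_ : NormedAddCommGroup H) (_ : InnerProductSpace ℂ H) (_ : CompleteSpace H)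
      (πA : A →⋆ₙₐ[ℂ] (H →L[ℂ] H)),
      IsNondegenerateRep πA ∧
        CPMapsMoritaEquivalent ((πA : A →ₗ[ℂ] (H →L[ℂ] H)) ∘ₗ EA)
          ((πB : B →ₗ[ℂ] (K →L[ℂ] K)) ∘ₗ EB) := by
  have _ : IsClosed (A : Set C) := hA
  have hX := hE.inclusions
  obtain ⟨L, _, _, _, Λ, hΛ, hΛin, hΛbal⟩ := hEB.exists_dilation hB πB S.rsmul S.rinner
    S.rinner_rsmul S.star_rinner S.rinner_self_nonneg
  obtain ⟨M, _, _, _, Θ, hΘ, hΘin, hΘbal⟩ := hEB.exists_dilation hB πB (LinearMap.mul ℂ D).flip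
    (LinearMap.mk₂'ₛₗ (starRingEnd ℂ) (RingHom.id ℂ) (fun x y ↦ star x * y)
      (by simp [add_mul]) (fun c x y ↦ by rw [star_smul, smul_mul_assoc]; rfl) (by simp [mul_add])
      (fun c x y ↦ mul_smul_comm c _ y))
    (fun d x y ↦ (mul_assoc _ _ _).symm) (fun x y ↦ by simp) (fun x ↦ star_mul_self_nonneg x)
  replace hΘin : ∀ x y ξ η, ⟪Θ x ξ, Θ y η⟫_ℂ = ⟪ξ, πB (EB (star x * y)) η⟫_ℂ := hΘin
  obtain ⟨πC, hπC⟩ := hΛ.exists_rep S.lsmul S.lsmul_mul fun c y y' ξ η ↦ by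
    rw [hΛin, hΛin, S.rinner_lsmul]
  obtain ⟨πD, hπD⟩ := hΘ.exists_rep (LinearMap.mul ℂ D) (fun c c' y ↦ mul_assoc _ _ _)
    fun c y y' ξ η ↦ by
      rw [hΘin, hΘin, LinearMap.mul_apply', LinearMap.mul_apply', star_mul, mul_assoc]
  obtain ⟨W, hW⟩ := hEB.exists_minimalStinespring hπB hΘ hΘin hΘbal hπD
  obtain ⟨H, _, _, _, Γ, V, hΓ, hVΓ⟩ := exists_restricted_family Λ X
  have hΓin : ∀ x y ξ η, ⟪Γ x ξ, Γ y η⟫_ℂ = ⟪ξ, πB (EB (S.rinner x y)) η⟫_ℂ := fun x y ξ η ↦ by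
    rw [← V.inner_map_map, hVΓ, hVΓ, hΛin]
  obtain ⟨πA, hπA⟩ := hΓ.exists_rep (C := A)
    (LinearMap.mk₂ ℂ (fun a x ↦ ⟨S.lsmul a x, hX.lsmul_mem a a.2 x x.2⟩)
      (fun a b x ↦ Subtype.ext (by simp)) (fun c a x ↦ Subtype.ext (by simp))
      (fun a x y ↦ Subtype.ext (by simp)) (fun c a x ↦ Subtype.ext (by simp)))
    (fun a b x ↦ Subtype.ext (S.lsmul_mul a b x))
    fun a x y ξ η ↦ by
      rw [hΓin, hΓin]
      exact congrArg (fun d ↦ ⟪ξ, πB (EB d) η⟫_ℂ) (S.rinner_lsmul a x y)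
  have hVπA : ∀ a x ξ, V (πA a (Γ x ξ)) = Λ (S.lsmul a x) ξ := fun a x ξ ↦ by
    rw [hπA, hVΓ]
    rfl
  have hSt : IsMinimalStinespring ((πA : A →ₗ[ℂ] (H →L[ℂ] H)) ∘ₗ EA) πC
      V.toContinuousLinearMap := by
    refine ⟨fun c ↦ hΓ.ext fun x ξ ↦ hΓ.ext_inner fun z η ↦ ?_, hΛ.dense_of_forall_mem fun y ↦
      mem_of_forall_generator_mem hB hπB hX.closure_rinner (Λ y)
        (Submodule.isClosed_topologicalClosure _) ?_⟩
    -- Both sides are matrix coefficients of `πB ∘ EB`, at `⟨z, EA(c)·x⟩ = EB ⟨z, c·x⟩` and at `⟨z,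
    -- c·x⟩`; they agree because `EB` is idempotent.
    · change ⟪Γ z η, πA (EA c) (Γ x ξ)⟫_ℂ = ⟪Γ z η, ContinuousLinearMap.adjoint
        V.toContinuousLinearMap (πC c (V (Γ x ξ)))⟫_ℂ
      rw [ContinuousLinearMap.adjoint_inner_right, LinearIsometry.coe_toContinuousLinearMap,
        ← V.inner_map_map, hVπA, hVΓ, hVΓ, hπC, hΛin, hΛin, hE.rinner_map c x x.2 z z.2,
        hEB.map_coe]
    -- For `b = ⟨x, x'⟩`, `y ⊗ πB(b) ξ = y·⟨x, x'⟩ ⊗ ξ = ⟨y, x⟩·x' ⊗ ξ`, which lies in `πC(C) V H`.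
    · rintro b ⟨x, hx, x', hx', hb⟩ ξ
      refine Submodule.le_topologicalClosure _ (Submodule.subset_span
        ⟨S.linner y x, Γ ⟨x', hx'⟩ ξ, ?_⟩)
      rw [LinearIsometry.coe_toContinuousLinearMap, hVΓ, hπC, S.linner_lsmul_eq, ← hb, hΛbal]
  refine ⟨H, inferInstance, inferInstance, inferInstance, πA, ?_, L, inferInstance, inferInstance,
    inferInstance, πC, V.toContinuousLinearMap, M, inferInstance, inferInstance, inferInstance,
    πD, W, hSt, hW, Y, inferInstance, inferInstance, inferInstance, S,
    S.exists_isBimoduleRep (φ := fun d ↦ πB (EB d)) hΛ hΛin hΘ hΘin hπC hπD hSt.isNondegenerateRep hW.isNondegenerateRep⟩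
  -- Non-degeneracy of `πA` is the same computation with `y ∈ X`, where `⟨y, x⟩` now lies in `A`.
  refine hΓ.dense_of_forall_mem fun y ↦ mem_of_forall_generator_mem hB hπB hX.closure_rinner (Γ y)
    (Submodule.isClosed_topologicalClosure _) ?_
  rintro b ⟨x, hx, x', hx', hb⟩ ξ
  refine Submodule.le_topologicalClosure _ (Submodule.subset_span
    ⟨⟨S.linner y x, hX.linner_mem y y.2 x hx⟩, Γ ⟨x', hx'⟩ ξ, V.injective ?_⟩)
  rw [hVπA, hVΓ, S.linner_lsmul_eq, ← hb, hΛbal]
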